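/- Let $\mathbf{P} = (P,\preceq_+,\preceq_-)$ be a double poset, i.e. a finite set $P$ with two partial orders, and write $P_\pm = (P,\preceq_\pm)$. Assume that $\mathbf{P}$ is compatible, i.e. $P_+$ and $P_-$ have a common linear extension. For a poset $Q$, let $\mathcal{O}(Q) \subseteq \mathbb{R}^Q$ be its order polytope (the set of order-preserving maps $Q \to [0,1]$) and let $\mathcal{J}(Q)$ be its Birkhoff lattice (the filters, i.e. up-closed subsets, of $Q$, ordered by inclusion). The double order polytope is $$\mathbb{T}\mathcal{O}(\mathbf{P}) = \operatorname{conv}\bigl( (2\,\mathcal{O}(P_+) \times \{1\}) \cup (-2\,\mathcal{O}(P_-) \times \{-1\}) \bigr) \subseteq \mathbb{R}^P \times \mathbb{R}.$$ For a subset $\mathcal{L} \subseteq \mathcal{J}(P_+) \uplus \mathcal{J}(P_-)$ of the disjoint union put $\mathcal{L}_\sigma = \mathcal{L} \cap \mathcal{J}(P_\sigma)$ for $\sigma = \pm$, and $$\overline{F}(\mathcal{L}) = \operatorname{conv}\bigl( \{(2\cdot\mathbf{1}_{F}, 1) : F \in \mathcal{L}_+\} \cup \{(-2\cdot\mathbf{1}_{F},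 -1) : F \in \mathcal{L}_-\} \bigr).$$ A subset $\mathcal{K} \subseteq \mathcal{J}(Q)$ is called an embedded sublattice if for all $F, F' \in \mathcal{J}(Q)$ one has $F \cup F',\, F \cap F' \in \mathcal{K}$ if and only if $F, F' \in \mathcal{K}$. Theorem. Let $\mathcal{L} \subseteq \mathcal{J}(P_+) \uplus \mathcal{J}(P_-)$. Then $\overline{F}(\mathcal{L})$ is a face of $\mathbb{T}\mathcal{O}(\mathbf{P})$ (that is, it is empty or the set of maximizers over $\mathbb{T}\mathcal{O}(\mathbf{P})$ of some linear function) if and only if (i) $\mathcal{L}_+ \subseteq \mathcal{J}(P_+)$ and $\mathcal{L}_- \subseteq \mathcal{J}(P_-)$ are embedded sublattices, and (ii) for all filters $F_+ \subseteq F_+'$ in $\mathcal{J}(P_+)$ and $F_- \subseteq F_-'$ in $\mathcal{J}(P_-)$ such that $F_+' \setminus F_+ = F_-' \setminus F_-$, one has $\{F_+, F_-\} \subseteq \mathcal{L}$ if and only if $\{F_+', F_-'\} \subseteq \mathcal{L}$. -/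

import Mathlib

open scoped Pointwise

/-- A double poset: two partial orders on the same ground set. -/
structure DoublePoset (P : Type*) where
  /-- the order `≼₊` -/
  plus : PartialOrder P
  /-- the order `≼₋` -/
  minus : PartialOrder P

/-- The order polytope of a poset: all order-preserving maps `P → [0, 1]`. -/
def orderPolytope {P : Type*} (r : PartialOrder P) : Set (P → ℝ) :=
  {f | (∀ a, 0 ≤ f a ∧ f a ≤ 1) ∧ ∀ a b, r.le a b → f a ≤ f b}

/-- The Birkhoff lattice of a poset: the filters (up-closed subsets) of `P`, as a sublattice of
the lattice of all subsets of `P`; so the order is inclusion, join is union and meet is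
intersection. -/
def birkhoff {P : Type*} (r : PartialOrder P) : Sublattice (Set P) where
  carrier := {F | ∀ a b, r.le a b → a ∈ F → b ∈ F}
  supClosed' := fun _ hF _ hG a b hab h =>
    h.elim (fun h => Or.inl (hF a b hab h)) (fun h => Or.inr (hG a b hab h))
  infClosed' := fun _ hF _ hG a b hab h => ⟨hF a b hab h.1, hG a b hab h.2⟩

/-- A collection `L` of filters is an embedded sublattice of the Birkhoff lattice if, for any two
filters, their union and intersection both lie in `L` if and only if they both lie in `L`. -/
def IsEmbeddedSublattice {P : Type*} {r : PartialOrder P} (L : Set (birkhoff r)) : Prop :=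
  ∀ F F' : birkhoff r, (F ⊔ F' ∈ L ∧ F ⊓ F' ∈ L) ↔ (F ∈ L ∧ F' ∈ L)

namespace DoublePoset

variable {P : Type*} (D : DoublePoset P)

/-- The two orders have a common linear extension. -/
def Compatible : Prop :=
  ∃ l : LinearOrder P,
    (∀ a b, D.plus.le a b → l.le a b) ∧ (∀ a b, D.minus.le a b → l.le a b)

/-- The double order polytope `conv ((2 O(P₊) × {1}) ∪ (-2 O(P₋) × {-1}))` in `ℝ^P × ℝ`. -/
def doubleOrderPolytope : Set ((P → ℝ) × ℝ) :=
  convexHull ℝ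
    (((2 : ℝ) • orderPolytope D.plus) ×ˢ {(1 : ℝ)} ∪
      ((-2 : ℝ) • orderPolytope D.minus) ×ˢ {(-1 : ℝ)})

/-- The double Birkhoff lattice: the disjoint union of the two Birkhoff lattices. -/
abbrev DoubleBirkhoff : Type _ := birkhoff D.plus ⊕ birkhoff D.minus

variable {D}

/-- `L₊`, the part of `L` consisting of filters of `P₊`. -/
def plusPart (L : Set D.DoubleBirkhoff) : Set (birkhoff D.plus) := {F | Sum.inl F ∈ L}

/-- `L₋`, the part of `L` consisting of filters of `P₋`. -/
def minusPart (L : Set D.DoubleBirkhoff) : Set (birkhoff D.minus) := {F | Sum.inr F ∈ L}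

/-- The convex hull of the points `(2·1_F, 1)` for `F ∈ L₊` and `(-2·1_F, -1)` for `F ∈ L₋`. -/
noncomputable def spannedBy (L : Set D.DoubleBirkhoff) : Set ((P → ℝ) × ℝ) :=
  convexHull ℝ
    ((fun F : birkhoff D.plus => ((2 : ℝ) • (F : Set P).indicator (1 : P → ℝ), (1 : ℝ))) ''
        plusPart L ∪
      (fun F : birkhoff D.minus => ((-2 : ℝ) • (F : Set P).indicator (1 : P → ℝ), (-1 : ℝ))) ''
        minusPart L)

/-- For all filters `F₊ ⊆ F₊'` of `P₊` and `F₋ ⊆ F₋'` of `P₋` with `F₊' \ F₊ = F₋' \ F₋`, both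
`F₊, F₋` lie in `L` if and only if both `F₊', F₋'` lie in `L`. -/
def Cooperating (L : Set D.DoubleBirkhoff) : Prop :=
  ∀ (F₁ F₁' : birkhoff D.plus) (F₂ F₂' : birkhoff D.minus), F₁ ≤ F₁' → F₂ ≤ F₂' →
    (F₁' : Set P) \ (F₁ : Set P) = (F₂' : Set P) \ (F₂ : Set P) →
      ((F₁ ∈ plusPart L ∧ F₂ ∈ minusPart L) ↔ (F₁' ∈ plusPart L ∧ F₂' ∈ minusPart L))

end DoublePoset

/-! On the vertices a linear functional amounts, up to the last coordinate, to a modular set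
function φ that is maximal exactly on `L₊` and minimal exactly on `L₋`. Modularity gives (i). It
also gives (ii), since φ(F₊) - φ(F₋) does not change when the same set is added to both filters.

Conversely, a single functional has to serve both sides. A nonempty embedded sublattice consists of
the filters that turn its tight relations into equalities, where "always in" and "never in" count as
relations to an added top and bottom (`IsEmbeddedSublattice.mem_of_forall_isTight`). Read these
relations as arcs of a network from bottom to top. Positive arc weights define a functional, outflow
minus inflow at each vertex, that is maximized exactly on the sublattice.

The functionals of the two sides are opposite precisely when the weights form a flow on the
superposed networks. Compatibility makes that network acyclic, so a positive flow exists once every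
vertex has an incoming arc if and only if it has an outgoing one (`exists_positive_flow`). Condition
(ii) for singleton differences supplies this (`Cooperating.isTiedBelow_iff`). The last coordinate
then equalizes the two maxima. -/

/-! ### Embedded sublattices of the Birkhoff lattice -/

section Birkhoff

variable {P : Type*} {r : PartialOrder P}

/-- `a` lies strictly below `b`, and no member of `L` separates the two. -/
def IsTight (L : Set (birkhoff r)) (a b : P) : Prop :=
  r.le a b ∧ a ≠ b ∧ ∀ F ∈ L, b ∈ (F : Set P) → a ∈ (F : Set P)

theorem birkhoff_mem_of_le (F : birkhoff r) {a b : P} (h : r.le a b) (ha : a ∈ (F : Set P)) :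
    b ∈ (F : Set P) :=
  F.2 a b h ha

/-- An embedded sublattice is determined by the order relations that become equalities on it. -/
theorem IsEmbeddedSublattice.mem_of_forall_isTight [Finite P] {L : Set (birkhoff r)}
    (hL : IsEmbeddedSublattice L) (hne : L.Nonempty) (F : birkhoff r)
    (hE : ∀ a b, IsTight L a b → b ∈ (F : Set P) → a ∈ (F : Set P))
    (hT : ∀ a, (∀ G ∈ L, a ∈ (G : Set P)) → a ∈ (F : Set P))
    (hB : ∀ a, (∀ G ∈ L, a ∉ (G : Set P)) → a ∉ (F : Set P)) : F ∈ L := by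
  have hsup : ∀ G ∈ L, ∀ G' ∈ L, G ⊔ G' ∈ L := fun G h G' h' => ((hL G G').2 ⟨h, h'⟩).1
  have hinf : ∀ G ∈ L, ∀ G' ∈ L, G ⊓ G' ∈ L := fun G h G' h' => ((hL G G').2 ⟨h, h'⟩).2
  obtain ⟨m, hm⟩ := (Set.toFinite L).exists_minimal hne
  obtain ⟨M, hM⟩ := (Set.toFinite L).exists_maximal hne
  have hmF : m ≤ F := fun a ha => hT a fun G hG =>
    (hm.le_of_le (hinf m hm.prop G hG) inf_le_left ha).2
  have hFM : F ≤ M := fun a ha => by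
    by_contra haM
    exact hB a (fun G hG haG =>
      haM (hM.le_of_ge (hsup M hM.prop G hG) le_sup_left (Or.inr haG))) ha
  -- If `F ∉ L`, then `H < F`. The goal is a member of `L` below `F` that is strictly larger than
  -- `H`; it will be `G ⊓ F`.
  obtain ⟨H, hH⟩ := (Set.toFinite {G | G ∈ L ∧ G ≤ F}).exists_maximal ⟨m, hm.prop, hmF⟩
  by_contra hFL
  have hFH : ¬ F ≤ H := fun h => hFL (le_antisymm h hH.prop.2 ▸ hH.prop.1)
  obtain ⟨G, hG⟩ := (Set.toFinite {G | G ∈ L ∧ H ≤ G ∧ ¬ G ⊓ F ≤ H}).exists_minimal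
    ⟨M, hM.prop, hH.prop.2.trans hFM, by rwa [inf_eq_right.2 hFM]⟩
  have hHG : H < G := lt_of_le_of_ne hG.prop.2.1 fun h => hG.prop.2.2 (h ▸ inf_le_left)
  obtain ⟨K, hK⟩ := (Set.toFinite {K | K ∈ L ∧ H ≤ K ∧ K < G}).exists_maximal
    ⟨H, hH.prop.1, le_rfl, hHG⟩
  have hKF : K ⊓ F ≤ H := by
    by_contra h
    exact hK.prop.2.2.not_ge (hG.le_of_le ⟨hK.prop.1, hK.prop.2.1, h⟩ hK.prop.2.2.le)
  have hKG : (K : Set P) ⊆ G := hK.prop.2.2.le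
  -- `K` is a lower cover of `G` inside `L`, so `(Q ⊓ G) ⊔ K` is `K` or `G`: no member of `L` splits
  -- `G \ K`.
  have hblock : ∀ x y, x ∈ (G : Set P) → x ∉ (K : Set P) → y ∈ (G : Set P) →
      y ∉ (K : Set P) → ∀ Q ∈ L, y ∈ (Q : Set P) → x ∈ (Q : Set P) := by
    intro x y hxG hxK hyG hyK Q hQ hyQ
    have hmem : (Q ⊓ G) ⊔ K ∈ L := hsup _ (hinf Q hQ G hG.prop.1) K hK.prop.1
    have hle : (Q ⊓ G) ⊔ K ≤ G := sup_le inf_le_right hK.prop.2.2.le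
    by_cases hlt : (Q ⊓ G) ⊔ K < G
    · exact absurd (hK.le_of_ge ⟨hmem, hK.prop.2.1.trans le_sup_right, hlt⟩ le_sup_right
        (Or.inl ⟨hyQ, hyG⟩)) hyK
    · have heq : (Q ⊓ G) ⊔ K = G := eq_of_le_of_not_lt hle hlt
      have hx : x ∈ (((Q ⊓ G) ⊔ K : birkhoff r) : Set P) := by rw [heq]; exact hxG
      rcases hx with hx | hx
      · exact hx.1
      · exact absurd hx hxK
  -- A complement of `G ⊓ F` between `H` and `G`. It is a filter because order relations inside `G \
  -- K` are tight, hence respected by `F` in both directions. The embedded property then pulls `G ⊓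
  -- F` into `L`.
  let Y : birkhoff r := ⟨(K : Set P) ∪ ((G : Set P) \ F), by
    rintro x y hxy (hx | ⟨hxG, hxF⟩)
    · exact Or.inl (birkhoff_mem_of_le K hxy hx)
    · by_cases hyK : y ∈ (K : Set P)
      · exact Or.inl hyK
      · have hyG := birkhoff_mem_of_le G hxy hxG
        refine Or.inr ⟨hyG, fun hyF => hxF ?_⟩
        by_cases hxy' : x = y
        · exact hxy' ▸ hyF
        · exact hE x y ⟨hxy, hxy', hblock x y hxG
            (fun h => hyK (birkhoff_mem_of_le K hxy h)) hyG hyK⟩ hyF⟩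
  have hsupY : (G ⊓ F) ⊔ Y = G := by
    apply Subtype.ext
    change ((G : Set P) ∩ F) ∪ ((K : Set P) ∪ ((G : Set P) \ F)) = G
    ext x
    have := @hKG x
    simp only [Set.mem_union, Set.mem_inter_iff, Set.mem_sdiff]
    tauto
  have hinfY : (G ⊓ F) ⊓ Y = H := by
    apply Subtype.ext
    change ((G : Set P) ∩ F) ∩ ((K : Set P) ∪ ((G : Set P) \ F)) = H
    ext x
    have h1 : x ∈ (K : Set P) → x ∈ (F : Set P) → x ∈ (H : Set P) := fun h h' => hKF ⟨h, h'⟩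
    have h2 : x ∈ (H : Set P) → x ∈ (F : Set P) := fun h => hH.prop.2 h
    have h3 : x ∈ (H : Set P) → x ∈ (K : Set P) := fun h => hK.prop.2.1 h
    have := @hKG x
    simp only [Set.mem_union, Set.mem_inter_iff, Set.mem_sdiff]
    tauto
  have hX : G ⊓ F ∈ L :=
    ((hL (G ⊓ F) Y).1 ⟨by rw [hsupY]; exact hG.prop.1, by rw [hinfY]; exact hH.prop.1⟩).1
  exact hG.prop.2.2 (hH.le_of_ge ⟨hX, inf_le_right⟩ (le_inf hG.prop.2.1 hH.prop.2))

/-- `a` is forced to the top by `L`, or tied to an element above it. -/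
def IsTiedAbove (L : Set (birkhoff r)) (a : P) : Prop :=
  (∀ F ∈ L, a ∈ (F : Set P)) ∨ ∃ b, IsTight L a b

/-- `a` is forced to the bottom by `L`, or tied to an element below it. -/
def IsTiedBelow (L : Set (birkhoff r)) (a : P) : Prop :=
  (∀ F ∈ L, a ∉ (F : Set P)) ∨ ∃ b, IsTight L b a

/-- A maximal member of `L` avoiding `a` contains everything strictly above `a`: otherwise its union
with a member separating `a` from such an element would be larger. Hence `a` can be added. If the
enlarged filter is again in `L`, it separates `a` from all elements below. -/
theorem IsEmbeddedSublattice.exists_insert [Finite P] {L : Set (birkhoff r)}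
    (hL : IsEmbeddedSublattice L) {a : P} (ha : ¬ IsTiedAbove L a) :
    ∃ F ∈ L, ∃ F' : birkhoff r, F ≤ F' ∧ (F' : Set P) \ F = {a} ∧
      (F' ∈ L → ¬ IsTiedBelow L a) := by
  simp only [IsTiedAbove, IsTight, not_or, not_forall, not_exists, not_and] at ha
  obtain ⟨⟨F₀, hF₀, haF₀⟩, hb⟩ := ha
  obtain ⟨F, hF⟩ := (Set.toFinite {F | F ∈ L ∧ a ∉ (F : Set P)}).exists_maximal ⟨F₀, hF₀, haF₀⟩
  have hup : ∀ b, r.le a b → a ≠ b → b ∈ (F : Set P) := by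
    intro b hab hne
    obtain ⟨Q, hQ, hbQ, haQ⟩ := hb b hab hne
    exact hF.le_of_ge ⟨((hL F Q).2 ⟨hF.prop.1, hQ⟩).1, fun h => h.elim hF.prop.2 haQ⟩
      le_sup_left (Or.inr hbQ)
  refine ⟨F, hF.prop.1, ⟨insert a (F : Set P), ?_⟩, Set.subset_insert _ _, ?_, ?_⟩
  · rintro x y hxy (rfl | hx)
    · by_cases h : x = y
      · exact Or.inl h.symm
      · exact Or.inr (hup y hxy h)
    · exact Or.inr (birkhoff_mem_of_le F hxy hx)
  · change insert a (F : Set P) \ F = {a}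
    ext x
    have := hF.prop.2
    simp only [Set.mem_sdiff, Set.mem_insert_iff, Set.mem_singleton_iff]
    constructor
    · tauto
    · rintro rfl
      exact ⟨Or.inl rfl, this⟩
  · rintro hF' (h | ⟨x, hxa, hne, h⟩)
    · exact h _ hF' (Set.mem_insert _ _)
    · rcases h _ hF' (Set.mem_insert _ _) with hx | hx
      · exact hne hx
      · exact hF.prop.2 (birkhoff_mem_of_le F hxa hx)

/-- Dual to `IsEmbeddedSublattice.exists_insert`, with a minimal member containing `a`. -/
theorem IsEmbeddedSublattice.exists_erase [Finite P] {L : Set (birkhoff r)}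
    (hL : IsEmbeddedSublattice L) {a : P} (ha : ¬ IsTiedBelow L a) :
    ∃ F' ∈ L, ∃ F : birkhoff r, F ≤ F' ∧ (F' : Set P) \ F = {a} ∧
      (F ∈ L → ¬ IsTiedAbove L a) := by
  simp only [IsTiedBelow, IsTight, not_or, not_forall, not_exists, not_and, not_not] at ha
  obtain ⟨⟨F₀, hF₀, haF₀⟩, hb⟩ := ha
  obtain ⟨F, hF⟩ := (Set.toFinite {F | F ∈ L ∧ a ∈ (F : Set P)}).exists_minimal ⟨F₀, hF₀, haF₀⟩
  have hdown : ∀ b, r.le b a → b ≠ a → b ∉ (F : Set P) := by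
    intro b hab hne hbF
    obtain ⟨Q, hQ, haQ, hbQ⟩ := hb b hab hne
    exact hbQ (hF.le_of_le ⟨((hL F Q).2 ⟨hF.prop.1, hQ⟩).2, hF.prop.2, haQ⟩ inf_le_left hbF).2
  refine ⟨F, hF.prop.1, ⟨(F : Set P) \ {a}, ?_⟩, Set.sdiff_subset, ?_, ?_⟩
  · rintro x y hxy ⟨hx, hxa⟩
    refine ⟨birkhoff_mem_of_le F hxy hx, ?_⟩
    rintro rfl
    exact hdown x hxy hxa hx
  · simpa using hF.prop.2
  · rintro hF' (h | ⟨y, hay, hne, h⟩)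
    · exact (h _ hF').2 rfl
    · exact (h _ hF' ⟨birkhoff_mem_of_le F hay hF.prop.2, fun h => hne h.symm⟩).2 rfl

end Birkhoff

/-! ### Positive flows -/

/-- An acyclic weighted network in which a vertex has an incoming arc if and only if it has an
outgoing one carries a flow that is positive on every arc. -/
theorem exists_positive_flow {P : Type*} [Fintype P] (l : LinearOrder P) (w : P → P → ℝ)
    (s t : P → ℝ) (hw : ∀ a b, 0 ≤ w a b) (hs : ∀ a, 0 ≤ s a) (ht : ∀ a, 0 ≤ t a)
    (hlt : ∀ a b, 0 < w a b → l.lt a b)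
    (hio : ∀ a, (0 < s a ∨ ∃ b, 0 < w b a) ↔ (0 < t a ∨ ∃ b, 0 < w a b)) :
    ∃ u : P → ℝ, (∀ a, (0 < t a ∨ ∃ b, 0 < w a b) → 0 < u a) ∧
      ∀ a, s a + ∑ b, w b a * u b = u a * (t a + ∑ b, w a b) := by
  classical
  have hwf : WellFounded l.lt := Finite.to_wellFoundedLT.wf
  have hN : ∀ a, 0 ≤ t a + ∑ b, w a b := fun a =>
    add_nonneg (ht a) (Finset.sum_nonneg fun b _ => hw a b)
  have hNpos : ∀ a, (0 < t a ∨ ∃ b, 0 < w a b) → 0 < t a + ∑ b, w a b := by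
    rintro a (h | ⟨b, h⟩)
    · exact add_pos_of_pos_of_nonneg h (Finset.sum_nonneg fun b _ => hw a b)
    · exact add_pos_of_nonneg_of_pos (ht a)
        (Finset.sum_pos' (fun b _ => hw a b) ⟨b, Finset.mem_univ _, h⟩)
  -- Flow is pushed upwards along `l`: the inflow at `a` is split equally per unit of outgoing
  -- weight. With no outgoing weight the quotient is 0 by convention, which is harmless since the
  -- inflow vanishes too.
  let step : ∀ a : P, (∀ b, l.lt b a → ℝ) → ℝ := fun a U =>
    (s a + ∑ b, if h : l.lt b a then w b a * U b h else 0) / (t a + ∑ b, w a b)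
  let u : P → ℝ := hwf.fix step
  have hu : ∀ a, u a = (s a + ∑ b, w b a * u b) / (t a + ∑ b, w a b) := by
    intro a
    have h := hwf.fix_eq step a
    change u a = (s a + ∑ b, if h : l.lt b a then w b a * u b else 0) / _ at h
    rw [h]
    congr 2
    refine Finset.sum_congr rfl fun b _ => ?_
    split_ifs with hb
    · rfl
    · rw [le_antisymm (not_lt.1 fun h => hb (hlt b a h)) (hw b a), zero_mul]
  have hu0 : ∀ a, 0 ≤ u a := by
    intro a
    induction a using hwf.induction with
    | _ a ih =>
      rw [hu]
      refine div_nonneg (add_nonneg (hs a) (Finset.sum_nonneg fun b _ => ?_)) (hN a)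
      rcases (hw b a).eq_or_lt with h | h
      · rw [← h, zero_mul]
      · exact mul_nonneg h.le (ih b (hlt b a h))
  have hsum : ∀ a, 0 ≤ ∑ b, w b a * u b := fun a =>
    Finset.sum_nonneg fun b _ => mul_nonneg (hw b a) (hu0 b)
  refine ⟨u, fun a => ?_, fun a => ?_⟩
  · induction a using hwf.induction with
    | _ a ih =>
      intro ha
      rw [hu]
      refine div_pos ?_ (hNpos a ha)
      rcases (hio a).2 ha with h | ⟨b, h⟩
      · exact add_pos_of_pos_of_nonneg h (hsum a)
      · exact add_pos_of_nonneg_of_pos (hs a) (Finset.sum_pos'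
          (fun b _ => mul_nonneg (hw b a) (hu0 b))
          ⟨b, Finset.mem_univ _, mul_pos h (ih b (hlt b a h) (Or.inr ⟨a, h⟩))⟩)
  · by_cases ha : 0 < t a ∨ ∃ b, 0 < w a b
    · rw [hu a, div_mul_cancel₀ _ (hNpos a ha).ne']
    · have ha' := mt (hio a).1 ha
      simp only [not_or, not_exists, not_lt] at ha ha'
      have h1 : ∀ b, w b a = 0 := fun b => le_antisymm (ha'.2 b) (hw b a)
      have h2 : ∀ b, w a b = 0 := fun b => le_antisymm (ha.2 b) (hw a b)
      simp [h1, h2, le_antisymm ha'.1 (hs a), le_antisymm ha.1 (ht a)]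

/-! ### Linear functionals on the Birkhoff lattice -/

section Functional

/-- The truth value of a proposition, as a real number. -/
noncomputable def truth (p : Prop) : ℝ := open Classical in if p then 1 else 0

theorem truth_nonneg (p : Prop) : 0 ≤ truth p := by
  unfold truth; split_ifs <;> norm_num

theorem truth_add_pos {p q : Prop} : 0 < truth p + truth q ↔ p ∨ q := by
  by_cases hp : p <;> by_cases hq : q <;> simp [truth, hp, hq]

theorem indicator_nonneg_one {P : Type*} (F : Set P) (a : P) : 0 ≤ F.indicator (1 : P → ℝ) a :=
  Set.indicator_nonneg (fun _ _ => zero_le_one) a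

theorem indicator_one_le {P : Type*} (F : Set P) (a : P) : F.indicator (1 : P → ℝ) a ≤ 1 :=
  Set.indicator_le_self' (fun _ _ => zero_le_one) a

variable {P : Type*} [Fintype P] {r : PartialOrder P}

/-- The value of the linear functional `c` at the indicator function of `F`. -/
noncomputable def weightOf (c : P → ℝ) (F : Set P) : ℝ := ∑ p, F.indicator (1 : P → ℝ) p * c p

/-- The functional with weight `u a` on each tight relation above `a`. -/
noncomputable def tightFunctional (L : Set (birkhoff r)) (u : P → ℝ) (p : P) : ℝ :=
  u p * (truth (∀ F ∈ L, p ∈ (F : Set P)) + ∑ b, truth (IsTight L p b)) -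
    (truth (∀ F ∈ L, p ∉ (F : Set P)) + ∑ a, truth (IsTight L a p) * u a)

/-- Summation by arcs instead of vertices: the gap to the maximum becomes a sum of slacks, one for
each tight relation, including those to top and bottom. -/
theorem sub_weightOf_tightFunctional (L : Set (birkhoff r)) (u : P → ℝ) (F : Set P) :
    ∑ p, u p * truth (∀ G ∈ L, p ∈ (G : Set P)) - weightOf (tightFunctional L u) F =
      ∑ p, (u p * truth (∀ G ∈ L, p ∈ (G : Set P)) * (1 - F.indicator 1 p) +
        truth (∀ G ∈ L, p ∉ (G : Set P)) * F.indicator 1 p +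
        ∑ b, truth (IsTight L p b) * u p * (F.indicator 1 b - F.indicator 1 p)) := by
  have h1 : ∑ p, F.indicator (1 : P → ℝ) p * ∑ a, truth (IsTight L a p) * u a =
      ∑ p, ∑ b, truth (IsTight L p b) * u p * F.indicator 1 b := by
    simp_rw [Finset.mul_sum]
    rw [Finset.sum_comm]
    exact Finset.sum_congr rfl fun _ _ => Finset.sum_congr rfl fun _ _ => by ring
  have h2 : weightOf (tightFunctional L u) F =
      ∑ p, (F.indicator 1 p * (u p * (truth (∀ F ∈ L, p ∈ (F : Set P)) +
        ∑ b, truth (IsTight L p b)) - truth (∀ F ∈ L, p ∉ (F : Set P)))) -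
      ∑ p, F.indicator (1 : P → ℝ) p * ∑ a, truth (IsTight L a p) * u a := by
    rw [weightOf, ← Finset.sum_sub_distrib]
    exact Finset.sum_congr rfl fun p _ => by rw [tightFunctional]; ring
  rw [h2, h1, ← Finset.sum_sub_distrib, ← Finset.sum_sub_distrib]
  refine Finset.sum_congr rfl fun p _ => ?_
  simp_rw [mul_sub, Finset.sum_sub_distrib, mul_add, ← Finset.sum_mul]
  ring

/-- The functional of a positive weighting of the tight relations of an embedded sublattice is
maximized exactly on the sublattice. -/
theorem IsEmbeddedSublattice.exists_max_weightOf {L : Set (birkhoff r)}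
    (hL : IsEmbeddedSublattice L) (hne : L.Nonempty) {u : P → ℝ}
    (hpos : ∀ a, IsTiedAbove L a → 0 < u a) :
    ∃ M, ∀ F : birkhoff r, weightOf (tightFunctional L u) F ≤ M ∧
      (weightOf (tightFunctional L u) F = M ↔ F ∈ L) := by
  refine ⟨∑ p, u p * truth (∀ G ∈ L, p ∈ (G : Set P)), fun F => ?_⟩
  have hsub := sub_weightOf_tightFunctional L u F
  have hT : ∀ p, 0 ≤ u p * truth (∀ G ∈ L, p ∈ (G : Set P)) * (1 - (F : Set P).indicator 1 p) := by
    intro p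
    refine mul_nonneg ?_ (sub_nonneg.2 (indicator_one_le _ _))
    by_cases h : ∀ G ∈ L, p ∈ (G : Set P)
    · exact mul_nonneg (hpos p (Or.inl h)).le (truth_nonneg _)
    · rw [truth, if_neg h, mul_zero]
  have hB : ∀ p, 0 ≤ truth (∀ G ∈ L, p ∉ (G : Set P)) * (F : Set P).indicator 1 p := fun p =>
    mul_nonneg (truth_nonneg _) (indicator_nonneg_one _ _)
  have hE : ∀ p b, 0 ≤ truth (IsTight L p b) * u p *
      ((F : Set P).indicator 1 b - (F : Set P).indicator 1 p) := by
    intro p b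
    by_cases h : IsTight L p b
    · refine mul_nonneg (mul_nonneg (truth_nonneg _) (hpos p (Or.inr ⟨b, h⟩)).le) ?_
      by_cases hp : p ∈ (F : Set P)
      · simp [hp, birkhoff_mem_of_le F h.1 hp]
      · simpa [hp] using indicator_nonneg_one (F : Set P) b
    · simp [truth, h]
  have hEs : ∀ p, 0 ≤ ∑ b, truth (IsTight L p b) * u p *
      ((F : Set P).indicator 1 b - (F : Set P).indicator 1 p) := fun p =>
    Finset.sum_nonneg fun b _ => hE p b
  have hall : ∀ p ∈ Finset.univ, 0 ≤ u p * truth (∀ G ∈ L, p ∈ (G : Set P)) *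
        (1 - (F : Set P).indicator 1 p) +
      truth (∀ G ∈ L, p ∉ (G : Set P)) * (F : Set P).indicator 1 p +
      ∑ b, truth (IsTight L p b) * u p *
        ((F : Set P).indicator 1 b - (F : Set P).indicator 1 p) :=
    fun p _ => add_nonneg (add_nonneg (hT p) (hB p)) (hEs p)
  refine ⟨sub_nonneg.1 (hsub ▸ Finset.sum_nonneg hall), ?_⟩
  rw [eq_comm, ← sub_eq_zero, hsub, Finset.sum_eq_zero_iff_of_nonneg hall]
  constructor
  · intro h0
    have hsplit := fun p => by
      have h := h0 p (Finset.mem_univ _)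
      rw [add_eq_zero_iff_of_nonneg (add_nonneg (hT p) (hB p)) (hEs p),
        add_eq_zero_iff_of_nonneg (hT p) (hB p), and_assoc] at h
      exact h
    refine hL.mem_of_forall_isTight hne F (fun a b hab hb => ?_) (fun a ha => ?_) (fun a ha => ?_)
    · have h := (Finset.sum_eq_zero_iff_of_nonneg fun b _ => hE a b).1 (hsplit a).2.2 b
        (Finset.mem_univ _)
      by_contra haF
      simp [truth, hab, hb, haF, (hpos a (Or.inr ⟨b, hab⟩)).ne'] at h
    · have h := (hsplit a).1
      by_contra haF
      rw [truth, if_pos ha] at h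
      simp [haF, (hpos a (Or.inl ha)).ne'] at h
    · have h := (hsplit a).2.1
      intro haF
      rw [truth, if_pos ha] at h
      simp [haF] at h
  · intro hF p _
    have h1 : truth (∀ G ∈ L, p ∈ (G : Set P)) * (1 - (F : Set P).indicator 1 p) = 0 := by
      by_cases h : ∀ G ∈ L, p ∈ (G : Set P)
      · simp [h F hF]
      · rw [truth, if_neg h, zero_mul]
    have h2 : truth (∀ G ∈ L, p ∉ (G : Set P)) * (F : Set P).indicator 1 p = 0 := by
      by_cases h : ∀ G ∈ L, p ∉ (G : Set P)
      · simp [h F hF]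
      · rw [truth, if_neg h, zero_mul]
    rw [mul_assoc, h1, h2, mul_zero, add_zero, zero_add]
    refine Finset.sum_eq_zero fun b _ => ?_
    by_cases h : IsTight L p b
    · by_cases hp : p ∈ (F : Set P)
      · simp [hp, birkhoff_mem_of_le F h.1 hp]
      · simp [hp, mt (h.2.2 F hF) hp]
    · simp [truth, h]

end Functional

/-! ### Faces of convex hulls -/

/-- The set described by the conclusion is convex and contains `S`, so no compactness or finiteness
is needed. -/
theorem maximizers_convexHull {E : Type*} [AddCommGroup E] [Module ℝ E]
    {S : Set E} (f : E →ₗ[ℝ] ℝ) {M : ℝ} (hM : ∀ x ∈ S, f x ≤ M) {x : E}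
    (hx : x ∈ convexHull ℝ S) : f x < M ∨ f x = M ∧ x ∈ convexHull ℝ {y ∈ S | f y = M} := by
  have key : convexHull ℝ S ⊆ {x | f x < M ∨ f x = M ∧ x ∈ convexHull ℝ {y ∈ S | f y = M}} := by
    refine convexHull_min (fun y hy => ?_) ?_
    · rcases (hM y hy).lt_or_eq with h | h
      · exact Or.inl h
      · exact Or.inr ⟨h, subset_convexHull ℝ _ ⟨hy, h⟩⟩
    · rw [convex_iff_forall_pos]
      intro y hy z hz a b ha hb hab
      simp only [Set.mem_ofPred_eq, map_add, map_smul, smul_eq_mul]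
      have hb' : b = 1 - a := by linarith
      rcases hy with hy | ⟨hy, hy'⟩ <;> rcases hz with hz | ⟨hz, hz'⟩
      · left; subst hb'; nlinarith
      · left; subst hb'; nlinarith
      · left; subst hb'; nlinarith
      · right
        exact ⟨by rw [hy, hz, ← add_mul, hab, one_mul],
          convex_convexHull ℝ _ hy' hz' ha.le hb.le hab⟩
  exact key hx

/-! ### The order polytope as a convex hull -/

theorem isCompact_orderPolytope {P : Type*} (r : PartialOrder P) :
    IsCompact (orderPolytope r) := by
  have hpi : IsCompact (Set.univ.pi fun _ : P => Set.Icc (0 : ℝ) 1) :=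
    isCompact_univ_pi fun _ => isCompact_Icc
  refine hpi.of_isClosed_subset ?_ fun f hf p _ => hf.1 p
  have : orderPolytope r = (⋂ a, {f : P → ℝ | 0 ≤ f a} ∩ {f | f a ≤ 1}) ∩
      ⋂ a, ⋂ b, ⋂ _ : r.le a b, {f | f a ≤ f b} := by
    ext f
    simp [orderPolytope]
  rw [this]
  refine (isClosed_iInter fun a => (isClosed_le continuous_const (continuous_apply a)).inter
    (isClosed_le (continuous_apply a) continuous_const)).inter
    (isClosed_iInter fun a => isClosed_iInter fun b => isClosed_iInter fun _ =>
      isClosed_le (continuous_apply a) (continuous_apply b))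

theorem convex_orderPolytope {P : Type*} (r : PartialOrder P) : Convex ℝ (orderPolytope r) := by
  intro f hf g hg a b ha hb hab
  refine ⟨fun p => ⟨?_, ?_⟩, fun p q hpq => ?_⟩ <;>
    simp only [Pi.add_apply, Pi.smul_apply, smul_eq_mul]
  · exact add_nonneg (mul_nonneg ha (hf.1 p).1) (mul_nonneg hb (hg.1 p).1)
  · have h1 := mul_le_mul_of_nonneg_left (hf.1 p).2 ha
    have h2 := mul_le_mul_of_nonneg_left (hg.1 p).2 hb
    linarith
  · exact add_le_add (mul_le_mul_of_nonneg_left (hf.2 p q hpq) ha)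
      (mul_le_mul_of_nonneg_left (hg.2 p q hpq) hb)

/-- The indicator functions of the filters of a poset. -/
def filterIndicators {P : Type*} (r : PartialOrder P) : Set (P → ℝ) :=
  Set.range fun F : birkhoff r => (F : Set P).indicator 1

/-- Every `f` is the midpoint of `min (2f) 1` and `max (2f - 1) 0`, both in the polytope. For
extreme `f` this forces `f = min (2f) 1`, so `f` takes only the values 0 and 1. -/
theorem extremePoints_orderPolytope_subset {P : Type*} (r : PartialOrder P) :
    (orderPolytope r).extremePoints ℝ ⊆ filterIndicators r := by
  rintro f ⟨hf, hext⟩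
  have hlow : (fun p => min (2 * f p) 1) ∈ orderPolytope r :=
    ⟨fun p => ⟨le_min (by linarith [(hf.1 p).1]) zero_le_one, min_le_right _ _⟩,
      fun a b hab => min_le_min (by linarith [hf.2 a b hab]) le_rfl⟩
  have hhigh : (fun p => max (2 * f p - 1) 0) ∈ orderPolytope r :=
    ⟨fun p => ⟨le_max_right _ _, max_le (by linarith [(hf.1 p).2]) zero_le_one⟩,
      fun a b hab => max_le_max (by linarith [hf.2 a b hab]) le_rfl⟩
  have heq : (fun p => min (2 * f p) 1) = f := by
    refine hext hlow hhigh ⟨1 / 2, 1 / 2, by norm_num, by norm_num, by norm_num, ?_⟩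
    funext p
    simp only [Pi.add_apply, Pi.smul_apply, smul_eq_mul]
    rcases le_total (2 * f p) 1 with h | h
    · rw [min_eq_left h, max_eq_right (by linarith)]; ring
    · rw [min_eq_right h, max_eq_left (by linarith)]; ring
  have h01 : ∀ p, f p ≠ 1 → f p = 0 := by
    intro p hp
    have h : min (2 * f p) 1 = f p := congrFun heq p
    rcases min_choice (2 * f p) 1 with h' | h'
    · linarith
    · exact absurd (h.symm.trans h') hp
  refine ⟨⟨{p | f p = 1}, fun a b hab ha => ?_⟩, ?_⟩
  · exact le_antisymm (hf.1 b).2 (ha.symm.le.trans (hf.2 a b hab))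
  · funext p
    by_cases hp : f p = 1
    · simp [Set.indicator, hp]
    · simp [Set.indicator, h01 p hp]

theorem indicator_mem_orderPolytope {P : Type*} {r : PartialOrder P} (F : birkhoff r) :
    (F : Set P).indicator 1 ∈ orderPolytope r := by
  refine ⟨fun a => ⟨indicator_nonneg_one _ a, indicator_one_le _ a⟩, fun a b hab => ?_⟩
  by_cases ha : a ∈ (F : Set P)
  · simp [ha, birkhoff_mem_of_le F hab ha]
  · simpa [ha] using indicator_nonneg_one (F : Set P) b

/-- Krein–Milman; the closure is superfluous because the hull of a finite set is closed. -/
theorem orderPolytope_eq_convexHull {P : Type*} [Finite P] (r : PartialOrder P) :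
    orderPolytope r = convexHull ℝ (filterIndicators r) := by
  have hfin : (filterIndicators r).Finite := Set.finite_range _
  refine subset_antisymm ?_ (convexHull_min ?_ (convex_orderPolytope r))
  · rw [← closure_convexHull_extremePoints (isCompact_orderPolytope r) (convex_orderPolytope r)]
    exact closure_minimal (convexHull_mono (extremePoints_orderPolytope_subset r))
      (hfin.isClosed_convexHull ℝ)
  · rintro _ ⟨F, rfl⟩
    exact indicator_mem_orderPolytope F

theorem isExposed_convexHull {E : Type*} [AddCommGroup E] [Module ℝ E] [TopologicalSpace E]
    {S T : Set E} (f : E →L[ℝ] ℝ) {M : ℝ} (hM : ∀ x ∈ S, f x ≤ M)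
    (hT : T = {y ∈ S | f y = M}) : IsExposed ℝ (convexHull ℝ S) (convexHull ℝ T) := by
  intro hne
  have hTM : ∀ x ∈ convexHull ℝ T, f x = M := fun x hx =>
    convexHull_min (fun y hy => by rw [hT] at hy; exact hy.2)
      (convex_hyperplane f.toLinearMap.isLinear M) hx
  have hTS : convexHull ℝ T ⊆ convexHull ℝ S :=
    convexHull_mono (by rw [hT]; exact Set.sep_subset _ _)
  refine ⟨f, Set.ext fun x => ⟨fun hx => ⟨hTS hx, fun y hy => ?_⟩, fun hx => ?_⟩⟩
  · rw [hTM x hx]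
    rcases maximizers_convexHull f.toLinearMap hM hy with h | h
    · exact h.le
    · exact h.1.le
  · obtain ⟨y, hy⟩ := hne
    have hxM : M ≤ f x := hTM y hy ▸ hx.2 y (hTS hy)
    rcases maximizers_convexHull f.toLinearMap hM hx.1 with h | h
    · exact absurd hxM (not_le.2 h)
    · rw [hT]
      exact h.2

/-! ### Vertices of the double order polytope -/

namespace DoublePoset

/-- The point `(2·1_F, 1)`. -/
noncomputable def plusVertex {P : Type*} (F : Set P) : (P → ℝ) × ℝ :=
  ((2 : ℝ) • F.indicator (1 : P → ℝ), (1 : ℝ))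

/-- The point `(-2·1_F, -1)`. -/
noncomputable def minusVertex {P : Type*} (F : Set P) : (P → ℝ) × ℝ :=
  ((-2 : ℝ) • F.indicator (1 : P → ℝ), (-1 : ℝ))

/-- The points that span `spannedBy L`. -/
def vertexSet {P : Type*} {D : DoublePoset P} (L : Set D.DoubleBirkhoff) : Set ((P → ℝ) × ℝ) :=
  (fun F : birkhoff D.plus => plusVertex (F : Set P)) '' plusPart L ∪
    (fun F : birkhoff D.minus => minusVertex (F : Set P)) '' minusPart L

theorem spannedBy_eq {P : Type*} {D : DoublePoset P} (L : Set D.DoubleBirkhoff) :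
    spannedBy L = convexHull ℝ (vertexSet L) := rfl

theorem doubleOrderPolytope_eq {P : Type*} [Finite P] (D : DoublePoset P) :
    D.doubleOrderPolytope = convexHull ℝ (vertexSet (Set.univ : Set D.DoubleBirkhoff)) := by
  have hprod : ∀ (k t : ℝ) (r : PartialOrder P), (k • orderPolytope r) ×ˢ {t} =
      convexHull ℝ ((fun F : birkhoff r => (k • (F : Set P).indicator (1 : P → ℝ), t)) ''
        Set.univ) := by
    intro k t r
    have h : ((fun F : birkhoff r => (k • (F : Set P).indicator (1 : P → ℝ), t)) '' Set.univ) =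
        (k • filterIndicators r) ×ˢ {t} := by
      ext ⟨x, s⟩
      simp only [Set.image_univ, Set.mem_range, Prod.mk.injEq, Set.mem_prod, Set.mem_smul_set,
        filterIndicators, Set.mem_singleton_iff, exists_exists_eq_and]
      constructor
      · rintro ⟨F, h, rfl⟩
        exact ⟨⟨F, h⟩, rfl⟩
      · rintro ⟨⟨F, h⟩, rfl⟩
        exact ⟨F, h, rfl⟩
    rw [h, convexHull_prod, convexHull_singleton, convexHull_smul, orderPolytope_eq_convexHull]
  rw [doubleOrderPolytope, hprod, hprod, convexHull_convexHull_union_left,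
    convexHull_convexHull_union_right]
  rfl

section Extreme

variable {P : Type*}

/-- A parallelepiped all of whose vertices have the form `(±2·1_F, ±1)`. -/
def shearedCube (P : Type*) : Set ((P → ℝ) × ℝ) :=
  {x | x.2 ∈ Set.Icc (-1 : ℝ) 1 ∧ ∀ p, x.1 p - x.2 ∈ Set.Icc (-1 : ℝ) 1}

theorem convex_shearedCube : Convex ℝ (shearedCube P) := by
  intro x hx y hy a b ha hb hab
  refine ⟨convex_Icc (-1 : ℝ) 1 hx.1 hy.1 ha hb hab, fun p => ?_⟩
  have h := convex_Icc (-1 : ℝ) 1 (hx.2 p) (hy.2 p) ha hb hab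
  simp only [smul_eq_mul] at h
  convert h using 1
  simp only [Prod.fst_add, Prod.smul_fst, Pi.add_apply, Pi.smul_apply, smul_eq_mul, Prod.snd_add,
    Prod.smul_snd]
  ring

theorem eq_of_convex_combination {u w a b σ : ℝ} (hu : u ∈ Set.Icc (-1 : ℝ) 1)
    (hw : w ∈ Set.Icc (-1 : ℝ) 1) (ha : 0 < a) (hb : 0 < b) (hab : a + b = 1)
    (hσ : σ = 1 ∨ σ = -1) (h : a * u + b * w = σ) : u = σ := by
  obtain ⟨hu1, hu2⟩ := hu
  obtain ⟨hw1, hw2⟩ := hw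
  have hb' : b = 1 - a := by linarith
  subst hb'
  rcases hσ with rfl | rfl <;> nlinarith

/-- In the coordinates `x.2` and `x.1 p - x.2` the body is a cube, and sign vectors are its extreme
points. -/
theorem mem_extremePoints_shearedCube {x : (P → ℝ) × ℝ} (h2 : x.2 = 1 ∨ x.2 = -1)
    (h1 : ∀ p, x.1 p - x.2 = 1 ∨ x.1 p - x.2 = -1) :
    x ∈ (shearedCube P).extremePoints ℝ := by
  have hmem : ∀ {σ : ℝ}, σ = 1 ∨ σ = -1 → σ ∈ Set.Icc (-1 : ℝ) 1 := by
    rintro σ (rfl | rfl) <;> norm_num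
  refine ⟨⟨hmem h2, fun p => hmem (h1 p)⟩, ?_⟩
  rintro y hy z hz ⟨a, b, ha, hb, hab, rfl⟩
  have e2 : y.2 = a * y.2 + b * z.2 := eq_of_convex_combination hy.1 hz.1 ha hb hab h2 rfl
  refine Prod.ext (funext fun p => ?_) e2
  have e1 : y.1 p - y.2 = a * y.1 p + b * z.1 p - (a * y.2 + b * z.2) :=
    eq_of_convex_combination (hy.2 p) (hz.2 p) ha hb hab (h1 p) (by ring)
  change y.1 p = a * y.1 p + b * z.1 p
  linarith

theorem plusVertex_mem_extremePoints (F : Set P) :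
    plusVertex F ∈ (shearedCube P).extremePoints ℝ := by
  refine mem_extremePoints_shearedCube (Or.inl rfl) fun p => ?_
  by_cases hp : p ∈ F
  · left; simp [plusVertex, hp]; norm_num
  · right; simp [plusVertex, hp]

theorem minusVertex_mem_extremePoints (F : Set P) :
    minusVertex F ∈ (shearedCube P).extremePoints ℝ := by
  refine mem_extremePoints_shearedCube (Or.inr rfl) fun p => ?_
  by_cases hp : p ∈ F
  · right; simp [minusVertex, hp]; norm_num
  · left; simp [minusVertex, hp]

theorem indicator_one_injective {F G : Set P}
    (h : F.indicator (1 : P → ℝ) = G.indicator 1) : F = G :=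
  Set.indicator_one_inj ℝ h

theorem plusVertex_injective : Function.Injective (plusVertex : Set P → (P → ℝ) × ℝ) :=
  fun _ _ h => indicator_one_injective
    (smul_right_injective _ (two_ne_zero : (2 : ℝ) ≠ 0) (congrArg Prod.fst h))

theorem minusVertex_injective : Function.Injective (minusVertex : Set P → (P → ℝ) × ℝ) :=
  fun _ _ h => indicator_one_injective
    (smul_right_injective _ (by norm_num : (-2 : ℝ) ≠ 0) (congrArg Prod.fst h))

theorem plusVertex_ne_minusVertex (F G : Set P) : plusVertex F ≠ minusVertex G := fun h => by
  have h' : (1 : ℝ) = -1 := congrArg Prod.snd h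
  norm_num at h'

variable {D : DoublePoset P}

/-- A point extreme in the larger cube is extreme in the hull, hence one of its generators. This is
what lets `L` be recovered from `spannedBy L`. -/
theorem mem_vertexSet_of_extreme (L : Set D.DoubleBirkhoff) {x : (P → ℝ) × ℝ}
    (hx : x ∈ (shearedCube P).extremePoints ℝ) (hxL : x ∈ spannedBy L) : x ∈ vertexSet L := by
  have hsub : spannedBy L ⊆ shearedCube P := by
    rw [spannedBy_eq]
    refine convexHull_min ?_ convex_shearedCube
    rintro _ (⟨F, _, rfl⟩ | ⟨F, _, rfl⟩)
    · exact (plusVertex_mem_extremePoints _).1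
    · exact (minusVertex_mem_extremePoints _).1
  exact extremePoints_convexHull_subset
    (inter_extremePoints_subset_extremePoints_of_subset hsub ⟨hxL, hx⟩)

theorem plusVertex_mem_spannedBy {L : Set D.DoubleBirkhoff} {F : birkhoff D.plus} :
    plusVertex (F : Set P) ∈ spannedBy L ↔ F ∈ plusPart L := by
  refine ⟨fun h => ?_, fun h => subset_convexHull ℝ _ (Or.inl ⟨F, h, rfl⟩)⟩
  rcases mem_vertexSet_of_extreme L (plusVertex_mem_extremePoints _) h with
    ⟨G, hG, hGF⟩ | ⟨G, hG, hGF⟩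
  · rwa [← Subtype.ext (plusVertex_injective hGF)]
  · exact absurd hGF.symm (plusVertex_ne_minusVertex _ _)

theorem minusVertex_mem_spannedBy {L : Set D.DoubleBirkhoff} {F : birkhoff D.minus} :
    minusVertex (F : Set P) ∈ spannedBy L ↔ F ∈ minusPart L := by
  refine ⟨fun h => ?_, fun h => subset_convexHull ℝ _ (Or.inr ⟨F, h, rfl⟩)⟩
  rcases mem_vertexSet_of_extreme L (minusVertex_mem_extremePoints _) h with
    ⟨G, hG, hGF⟩ | ⟨G, hG, hGF⟩
  · exact absurd hGF (plusVertex_ne_minusVertex _ _)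
  · rwa [← Subtype.ext (minusVertex_injective hGF)]

end Extreme

/-! ### Faces satisfy the combinatorial conditions -/

section Necessity

variable {P : Type*} {D : DoublePoset P} {L : Set D.DoubleBirkhoff}

/-- A face spanned by vertices is cut out by a modular set function. -/
theorem exists_modular_of_isExposed [Finite P]
    (h : IsExposed ℝ D.doubleOrderPolytope (spannedBy L)) (hne : (spannedBy L).Nonempty) :
    ∃ (φ : Set P → ℝ) (m₁ m₂ : ℝ), (∀ F G, φ (F ∪ G) + φ (F ∩ G) = φ F + φ G) ∧ φ ∅ = 0 ∧
      (∀ F : birkhoff D.plus, φ F ≤ m₁ ∧ (F ∈ plusPart L ↔ φ F = m₁)) ∧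
      ∀ F : birkhoff D.minus, m₂ ≤ φ F ∧ (F ∈ minusPart L ↔ φ F = m₂) := by
  obtain ⟨f, hf⟩ := h hne
  obtain ⟨x₀, hx₀⟩ := hne
  have hx₀' := hx₀
  rw [hf] at hx₀'
  have hmem : ∀ v ∈ D.doubleOrderPolytope, (v ∈ spannedBy L ↔ f v = f x₀) := by
    intro v hv
    rw [hf]
    exact ⟨fun h => le_antisymm (hx₀'.2 v hv) (h.2 x₀ hx₀'.1),
      fun h => ⟨hv, fun y hy => h ▸ hx₀'.2 y hy⟩⟩
  have hplus : ∀ F : birkhoff D.plus, plusVertex (F : Set P) ∈ D.doubleOrderPolytope := fun F => by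
    rw [doubleOrderPolytope_eq]
    exact subset_convexHull ℝ _ (Or.inl ⟨F, trivial, rfl⟩)
  have hminus : ∀ F : birkhoff D.minus, minusVertex (F : Set P) ∈ D.doubleOrderPolytope :=
    fun F => by
      rw [doubleOrderPolytope_eq]
      exact subset_convexHull ℝ _ (Or.inr ⟨F, trivial, rfl⟩)
  let φ : Set P → ℝ := fun F => f (F.indicator 1, 0)
  have hfp : ∀ F, f (plusVertex F) = 2 * φ F + f (0, 1) := by
    intro F
    have : plusVertex F = (2 : ℝ) • (F.indicator 1, (0 : ℝ)) + (0, 1) := by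
      simp [plusVertex]
    rw [this, map_add, map_smul, smul_eq_mul]
  have hfm : ∀ F, f (minusVertex F) = -2 * φ F - f (0, 1) := by
    intro F
    have : minusVertex F = (-2 : ℝ) • (F.indicator 1, (0 : ℝ)) - (0, 1) := by
      simp [minusVertex]
    rw [this, map_sub, map_smul, smul_eq_mul]
  -- The bounds solve `2 * m₁ + f (0, 1) = f x₀` and `-2 * m₂ - f (0, 1) = f x₀`, where `f x₀` is
  -- the maximum.
  refine ⟨φ, (f x₀ - f (0, 1)) / 2, -(f x₀ + f (0, 1)) / 2, fun F G => ?_, ?_, fun F => ?_,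
    fun F => ?_⟩
  · change f _ + f _ = f _ + f _
    rw [← map_add, ← map_add, Prod.mk_add_mk, Prod.mk_add_mk, Set.indicator_union_add_inter]
  · change f _ = 0
    rw [Set.indicator_empty']
    exact map_zero f
  · have h1 := hx₀'.2 _ (hplus F)
    rw [hfp] at h1
    refine ⟨by linarith, ?_⟩
    rw [← plusVertex_mem_spannedBy, hmem _ (hplus F), hfp]
    constructor <;> intro h <;> linarith
  · have h1 := hx₀'.2 _ (hminus F)
    rw [hfm] at h1
    refine ⟨by linarith, ?_⟩
    rw [← minusVertex_mem_spannedBy, hmem _ (hminus F), hfm]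
    constructor <;> intro h <;> linarith

theorem conditions_of_isExposed [Finite P]
    (h : IsExposed ℝ D.doubleOrderPolytope (spannedBy L)) :
    (IsEmbeddedSublattice (plusPart L) ∧ IsEmbeddedSublattice (minusPart L)) ∧
      Cooperating L := by
  rcases (spannedBy L).eq_empty_or_nonempty with hemp | hne
  · have hp : ∀ F, F ∉ plusPart L := fun F hF => by
      have := plusVertex_mem_spannedBy.2 hF
      rw [hemp] at this
      exact this
    have hm : ∀ F, F ∉ minusPart L := fun F hF => by
      have := minusVertex_mem_spannedBy.2 hF
      rw [hemp] at this
      exact this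
    refine ⟨⟨fun F F' => ?_, fun F F' => ?_⟩, fun F₁ F₁' F₂ F₂' _ _ _ => ?_⟩ <;> simp [hp, hm]
  · obtain ⟨φ, m₁, m₂, hmod, hφ0, hp, hm⟩ := exists_modular_of_isExposed h hne
    have hdiff : ∀ {F F' : Set P}, F ⊆ F' → φ F' = φ F + φ (F' \ F) := by
      intro F F' hFF
      have := hmod F (F' \ F)
      rw [Set.union_sdiff_cancel hFF, Set.inter_sdiff_self, hφ0, add_zero] at this
      exact this
    refine ⟨⟨fun F F' => ?_, fun F F' => ?_⟩, fun F₁ F₁' F₂ F₂' h₁ h₂ hd => ?_⟩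
    -- Both pairs have the same sum, and a pair lies in `plusPart L` exactly when its sum reaches
    -- the upper bound `2 * m₁`.
    · have e : φ (F ⊔ F' : birkhoff D.plus) + φ (F ⊓ F' : birkhoff D.plus) = φ F + φ F' :=
        hmod F F'
      rw [(hp _).2, (hp _).2, (hp _).2, (hp _).2]
      have := (hp F).1
      have := (hp F').1
      have := (hp (F ⊔ F')).1
      have := (hp (F ⊓ F')).1
      constructor <;> rintro ⟨_, _⟩ <;> constructor <;> linarith
    · have e : φ (F ⊔ F' : birkhoff D.minus) + φ (F ⊓ F' : birkhoff D.minus) = φ F + φ F' :=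
        hmod F F'
      rw [(hm _).2, (hm _).2, (hm _).2, (hm _).2]
      have := (hm F).1
      have := (hm F').1
      have := (hm (F ⊔ F')).1
      have := (hm (F ⊓ F')).1
      constructor <;> rintro ⟨_, _⟩ <;> constructor <;> linarith
    -- Both pairs have the same difference of φ-values, and a pair lies in `L` exactly when this
    -- difference reaches its upper bound `m₁ - m₂`.
    · have e₁ := hdiff h₁
      have e₂ := hdiff h₂
      rw [← hd] at e₂
      rw [(hp _).2, (hp _).2, (hm _).2, (hm _).2]
      have := (hp F₁).1
      have := (hp F₁').1
      have := (hm F₂).1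
      have := (hm F₂').1
      constructor <;> rintro ⟨_, _⟩ <;> constructor <;> linarith

end Necessity

/-! ### The combinatorial conditions give a face -/

section Sufficiency

variable {P : Type*} {D : DoublePoset P} {L : Set D.DoubleBirkhoff}

/-- The coefficient `α` of the last coordinate raises the plus vertices and lowers the minus
vertices, so that arbitrary bounds `m₁`, `m₂` become one common value `M`. -/
theorem isExposed_of_weightOf [Fintype P] (c : P → ℝ) {m₁ m₂ : ℝ} (α : ℝ) (M : ℝ)
    (hm₁ : m₁ = (M - α) / 2) (hm₂ : m₂ = (M + α) / 2)
    (hp : ∀ F : birkhoff D.plus, weightOf c F ≤ m₁ ∧ (weightOf c F = m₁ ↔ F ∈ plusPart L))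
    (hm : ∀ F : birkhoff D.minus,
      weightOf (-c) F ≤ m₂ ∧ (weightOf (-c) F = m₂ ↔ F ∈ minusPart L)) :
    IsExposed ℝ D.doubleOrderPolytope (spannedBy L) := by
  let f : ((P → ℝ) × ℝ) →L[ℝ] ℝ :=
    (∑ p, c p • ContinuousLinearMap.proj (R := ℝ) (φ := fun _ : P => ℝ) p).comp
      (ContinuousLinearMap.fst ℝ (P → ℝ) ℝ) + α • ContinuousLinearMap.snd ℝ (P → ℝ) ℝ
  have hf : ∀ x, f x = ∑ p, c p * x.1 p + α * x.2 := fun x => by simp [f]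
  have hfp : ∀ F, f (plusVertex F) = 2 * weightOf c F + α := by
    intro F
    rw [hf, weightOf, Finset.mul_sum]
    simp only [plusVertex, Pi.smul_apply, smul_eq_mul, mul_one]
    congr 1
    exact Finset.sum_congr rfl fun p _ => by ring
  have hfm : ∀ F, f (minusVertex F) = 2 * weightOf (-c) F - α := by
    intro F
    rw [hf, weightOf, Finset.mul_sum, sub_eq_add_neg]
    simp only [minusVertex, Pi.smul_apply, smul_eq_mul, mul_neg, mul_one, Pi.neg_apply]
    congr 1
    exact Finset.sum_congr rfl fun p _ => by ring
  rw [doubleOrderPolytope_eq, spannedBy_eq]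
  refine isExposed_convexHull f (M := M) ?_ (Set.ext fun x => ⟨?_, ?_⟩)
  · rintro _ (⟨F, _, rfl⟩ | ⟨F, _, rfl⟩)
    · simp only [hfp]; linarith [(hp F).1]
    · simp only [hfm]; linarith [(hm F).1]
  · rintro (⟨F, hF, rfl⟩ | ⟨F, hF, rfl⟩)
    · refine ⟨Or.inl ⟨F, trivial, rfl⟩, ?_⟩
      simp only [hfp]; linarith [(hp F).2.2 hF]
    · refine ⟨Or.inr ⟨F, trivial, rfl⟩, ?_⟩
      simp only [hfm]; linarith [(hm F).2.2 hF]
  · rintro ⟨⟨F, _, rfl⟩ | ⟨F, _, rfl⟩, h⟩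
    · simp only [hfp] at h
      exact Or.inl ⟨F, (hp F).2.1 (by linarith), rfl⟩
    · simp only [hfm] at h
      exact Or.inr ⟨F, (hm F).2.1 (by linarith), rfl⟩

theorem exists_forall_weightOf_lt [Fintype P] (c : P → ℝ) (r : PartialOrder P) :
    ∃ C, ∀ F : birkhoff r, weightOf c F < C := by
  obtain ⟨C, hC⟩ := (Set.finite_range fun F : birkhoff r => weightOf c (F : Set P)).bddAbove
  exact ⟨C + 1, fun F => (hC ⟨F, rfl⟩).trans_lt (lt_add_one C)⟩

/-- If `a` is not tied above on either side, it can be added to a member on each side. Cooperation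
for the common difference `{a}` puts both enlarged filters into `L`, and so `a` is not tied below on
either side. Erasing `a` gives the converse. -/
theorem Cooperating.isTiedBelow_iff [Finite P] (hc : Cooperating L)
    (hp : IsEmbeddedSublattice (plusPart L)) (hm : IsEmbeddedSublattice (minusPart L)) (a : P) :
    (IsTiedBelow (plusPart L) a ∨ IsTiedBelow (minusPart L) a) ↔
      (IsTiedAbove (plusPart L) a ∨ IsTiedAbove (minusPart L) a) := by
  constructor
  · intro h
    by_contra hn
    rw [not_or] at hn
    obtain ⟨F₁, hF₁, F₁', hle₁, hd₁, h₁⟩ := hp.exists_insert hn.1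
    obtain ⟨F₂, hF₂, F₂', hle₂, hd₂, h₂⟩ := hm.exists_insert hn.2
    obtain ⟨h₁', h₂'⟩ := (hc F₁ F₁' F₂ F₂' hle₁ hle₂ (hd₁.trans hd₂.symm)).1 ⟨hF₁, hF₂⟩
    exact h.elim (h₁ h₁') (h₂ h₂')
  · intro h
    by_contra hn
    rw [not_or] at hn
    obtain ⟨F₁', hF₁, F₁, hle₁, hd₁, h₁⟩ := hp.exists_erase hn.1
    obtain ⟨F₂', hF₂, F₂, hle₂, hd₂, h₂⟩ := hm.exists_erase hn.2
    obtain ⟨h₁', h₂'⟩ := (hc F₁ F₁' F₂ F₂' hle₁ hle₂ (hd₁.trans hd₂.symm)).2 ⟨hF₁, hF₂⟩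
    exact h.elim (h₁ h₁') (h₂ h₂')

/-- There is a positive weighting of the tight relations for which the functionals of the two
parts of `L` are opposite to each other. -/
theorem exists_opposite_tightFunctional [Fintype P] (hD : D.Compatible) (hc : Cooperating L)
    (hp : IsEmbeddedSublattice (plusPart L)) (hm : IsEmbeddedSublattice (minusPart L)) :
    ∃ u : P → ℝ, (∀ a, IsTiedAbove (plusPart L) a → 0 < u a) ∧
      (∀ a, IsTiedAbove (minusPart L) a → 0 < u a) ∧
      tightFunctional (minusPart L) u = -tightFunctional (plusPart L) u := by
  obtain ⟨l, hl₁, hl₂⟩ := hD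
  -- Arc multiplicities of the superposed network; `s` counts arcs from the bottom and `t` arcs to
  -- the top.
  let w : P → P → ℝ := fun a b =>
    truth (IsTight (plusPart L) a b) + truth (IsTight (minusPart L) a b)
  let s : P → ℝ := fun a => truth (∀ F ∈ plusPart L, a ∉ (F : Set P)) +
    truth (∀ F ∈ minusPart L, a ∉ (F : Set P))
  let t : P → ℝ := fun a => truth (∀ F ∈ plusPart L, a ∈ (F : Set P)) +
    truth (∀ F ∈ minusPart L, a ∈ (F : Set P))
  have hbelow : ∀ a, (0 < s a ∨ ∃ b, 0 < w b a) ↔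
      (IsTiedBelow (plusPart L) a ∨ IsTiedBelow (minusPart L) a) := by
    intro a
    simp only [s, w, truth_add_pos, IsTiedBelow, exists_or]
    tauto
  have habove : ∀ a, (0 < t a ∨ ∃ b, 0 < w a b) ↔
      (IsTiedAbove (plusPart L) a ∨ IsTiedAbove (minusPart L) a) := by
    intro a
    simp only [t, w, truth_add_pos, IsTiedAbove, exists_or]
    tauto
  obtain ⟨u, hpos, hu⟩ := exists_positive_flow l w s t
    (fun _ _ => add_nonneg (truth_nonneg _) (truth_nonneg _))
    (fun _ => add_nonneg (truth_nonneg _) (truth_nonneg _))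
    (fun _ => add_nonneg (truth_nonneg _) (truth_nonneg _))
    (fun a b hab => by
      rcases truth_add_pos.1 hab with h | h
      · exact @lt_of_le_of_ne _ l.toPartialOrder _ _ (hl₁ a b h.1) h.2.1
      · exact @lt_of_le_of_ne _ l.toPartialOrder _ _ (hl₂ a b h.1) h.2.1)
    (fun a => by rw [hbelow, habove, hc.isTiedBelow_iff hp hm])
  refine ⟨u, fun a h => hpos a ((habove a).2 (Or.inl h)),
    fun a h => hpos a ((habove a).2 (Or.inr h)), funext fun p => ?_⟩
  -- Conservation at `p` says that the two functionals sum to zero there.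
  have h := hu p
  simp only [s, t, w, add_mul, Finset.sum_add_distrib] at h
  simp only [tightFunctional, Pi.neg_apply]
  linarith

theorem isExposed_of_conditions [Finite P] (hD : D.Compatible) (hc : Cooperating L)
    (hp : IsEmbeddedSublattice (plusPart L)) (hm : IsEmbeddedSublattice (minusPart L)) :
    IsExposed ℝ D.doubleOrderPolytope (spannedBy L) := by
  have := Fintype.ofFinite P
  rcases (plusPart L).eq_empty_or_nonempty with hp0 | hp0 <;>
    rcases (minusPart L).eq_empty_or_nonempty with hm0 | hm0
  · rintro ⟨x, hx⟩
    simp [spannedBy, hp0, hm0] at hx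
  -- With one side empty no balance is needed, so unit weights suffice. The strict bound `C` on the
  -- empty side is attained by no filter, and `α` is chosen to level `C` with `m`.
  · obtain ⟨m, h⟩ := hm.exists_max_weightOf hm0 (u := fun _ => 1) fun _ _ => one_pos
    set c := tightFunctional (minusPart L) fun _ => 1
    obtain ⟨C, hC⟩ := exists_forall_weightOf_lt (-c) D.plus
    refine isExposed_of_weightOf (-c) (m₁ := C) (m₂ := m) (m - C) (m + C) (by ring) (by ring)
      (fun F => ⟨(hC F).le, ?_⟩) (by simpa only [neg_neg] using h)
    simp [hp0, (hC F).ne]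
  · obtain ⟨m, h⟩ := hp.exists_max_weightOf hp0 (u := fun _ => 1) fun _ _ => one_pos
    set c := tightFunctional (plusPart L) fun _ => 1
    obtain ⟨C, hC⟩ := exists_forall_weightOf_lt (-c) D.minus
    refine isExposed_of_weightOf c (m₁ := m) (m₂ := C) (C - m) (m + C) (by ring) (by ring)
      h (fun F => ⟨(hC F).le, ?_⟩)
    simp [hm0, (hC F).ne]
  · obtain ⟨u, hu₁, hu₂, hopp⟩ := exists_opposite_tightFunctional hD hc hp hm
    obtain ⟨m₁, h₁⟩ := hp.exists_max_weightOf hp0 hu₁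
    obtain ⟨m₂, h₂⟩ := hm.exists_max_weightOf hm0 hu₂
    rw [hopp] at h₂
    exact isExposed_of_weightOf _ (m₂ - m₁) (m₁ + m₂) (by ring) (by ring) h₁ h₂

end Sufficiency

end DoublePoset

theorem mainTheorem2 {P : Type*} [Finite P] (D : DoublePoset P) (hD : D.Compatible)
    (L : Set D.DoubleBirkhoff) :
    IsExposed ℝ D.doubleOrderPolytope (DoublePoset.spannedBy L) ↔
      (IsEmbeddedSublattice (DoublePoset.plusPart L) ∧
          IsEmbeddedSublattice (DoublePoset.minusPart L)) ∧
        DoublePoset.Cooperating L :=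
  ⟨DoublePoset.conditions_of_isExposed, fun h =>
    DoublePoset.isExposed_of_conditions hD h.2 h.1.1 h.1.2⟩
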